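/- For pointed metric spaces $(A,p)$, $(B,q)$ let $d_{GH}((A,p),(B,q))$ be the pointed Gromov–Hausdorff distance, i.e. the infimum of $\max\{d_H(\varphi(A),\psi(B)),\, d(\varphi(p),\psi(q))\}$ over all isometric embeddings $\varphi,\psi$ of $A,B$ into a common metric space, and for $R\ge 0$ let $d_{GH}^R((A,p),(B,q))$ be the pointed Gromov–Hausdorff distance of the closed balls $(\bar B_R(p),p)$ and $(\bar B_R(q),q)$ with the restricted metrics. Products $\mathbb{R}^k\times X$ carry the metric $\sqrt{|u-v|^2+d_X(x,y)^2}$. **Lemma.** There is a universal constant $c>0$ such that the following holds. Let $(X,d_X)$ and $(Y,d_Y)$ be complete length spaces with $X$ compact, let $x_0\in X$, $y_0\in Y$, and put $\operatorname{rad}_Y(y_0):=\sup\{d_Y(y,y_0)\mid y\in Y\}\in[0,\infty]$. Let $k\in\mathbb{N}=\{0,1,2,\dots\}$ and $R>\operatorname{diam}(X)$, and write $\rho:=d_{GH}^R\big((\mathbb{R}^k\times X,(0,x_0)),(\mathbb{R}^k\times Y,(0,y_0))\big)$. (a) If $\varepsilon>0$, $\operatorname{diam}(X)+4\varepsilon\le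 \frac{2R}{3}$ and $\rho<\frac{\varepsilon}{2}$, then $$\min\{R,\operatorname{rad}_Y(y_0)\}^2\le \operatorname{diam}(X)^2+2\varepsilon\operatorname{diam}(X)+4\varepsilon(R+\varepsilon).$$ (b) If $Y$ is proper (closed balls are compact), $\operatorname{diam}(X)=0$ and $\rho<\frac{R}{12}$, then $Y$ is compact with $\operatorname{diam}(Y)<2R$. (c) If $Y$ is proper, $\operatorname{diam}(X)=1$, $R\ge 100$ and $\rho<\frac{1}{100R}$, then $Y$ is compact with $c\le\operatorname{diam}(Y)\le 5c$. (d) If $1000\cdot\operatorname{diam}(X)\le R<\frac12\operatorname{diam}(Y)$ (where $\operatorname{diam}(Y)\in[0,\infty]$), then $\rho\ge 20\cdot\operatorname{diam}(X)$. -/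

import Mathlib

open scoped ENNReal

universe u v

/-- A metric space is a length space if the distance of any two points is the infimum of the
lengths of the continuous paths joining them. -/
def IsLengthSpace (X : Type u) [MetricSpace X] : Prop :=
  ∀ x y : X, edist x y = ⨅ γ : Path x y, eVariationOn γ Set.univ

/-- The product `ℝ^k × X` with the product metric
`d((u, x), (v, y)) ^ 2 = ‖u - v‖ ^ 2 + d(x, y) ^ 2`. -/
abbrev EuclideanProd (k : ℕ) (X : Type u) : Type u :=
  WithLp 2 (EuclideanSpace ℝ (Fin k) × X)

/-- The point `(0, x)` of `ℝ^k × X`. -/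
def EuclideanProd.base (k : ℕ) {X : Type u} (x : X) : EuclideanProd k X :=
  WithLp.toLp 2 (0, x)

/-- The pointed Gromov-Hausdorff distance of `(A, p)` and `(B, q)`: the infimum, over all isometric
embeddings of `A` and `B` into a common metric space, of the maximum of the Hausdorff distance of
the images and the distance of the images of the base points. -/
noncomputable def pointedGHDist {A : Type u} {B : Type v} [MetricSpace A] [MetricSpace B]
    (p : A) (q : B) : ℝ≥0∞ :=
  ⨅ (Z : Type (max u v)) (_ : MetricSpace Z) (φ : A → Z) (ψ : B → Z)
    (_ : Isometry φ) (_ : Isometry ψ),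
    max (Metric.hausdorffEDist (Set.range φ) (Set.range ψ)) (edist (φ p) (ψ q))

/-- The pointed Gromov-Hausdorff distance of the closed balls of radius `r` around `p` and `q`,
each with the restricted metric and its centre as base point. -/
noncomputable def ballGHDist {A : Type u} {B : Type v} [MetricSpace A] [MetricSpace B]
    {r : ℝ} (hr : 0 ≤ r) (p : A) (q : B) : ℝ≥0∞ :=
  pointedGHDist (⟨p, Metric.mem_closedBall_self hr⟩ : Metric.closedBall p r)
    (⟨q, Metric.mem_closedBall_self hr⟩ : Metric.closedBall q r)

/-- The radius `sup {d(y, y₀) | y ∈ Y}` of `Y` from `y₀`, possibly infinite. -/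
noncomputable def radiusFrom {Y : Type v} [MetricSpace Y] (y₀ : Y) : ℝ≥0∞ :=
  ⨆ y : Y, edist y y₀

/-! A pointed distance below `ε / 2` gives maps of distortion less than `ε` between the balls, in
both directions. Let `f` be such a map into the ball of `ℝ^k × X`, with `k ≥ 1`. The points `(R u,
y₀)`, `u` on the unit sphere, all lie at distance `√(R² + d(y, y₀)²)` from `(0, y)`. The Euclidean
parts of their images form a nearly continuous family in the `R`-ball that keeps antipodes almost
`2R` apart, so by Borsuk–Ulam some image lies close to the ray through the Euclidean part of `f (0,
y)`. Those two parts are then at most about `R` apart, and the factor `X` adds at most `diam X`, so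
`d(y, y₀)²` is at most about `diam X² + O(εR)`: this is `EuclideanProd.dist_sq_le`. Since `Y` is
path connected, a bound below `R²` inside the `R`-ball holds on all of `Y`; the four claims are
choices of `ε`.

Borsuk–Ulam (`borsuk_ulam`) is proved algebraically. Approximation reduces it to a common zero on
the sphere of odd polynomials perturbed by high odd powers. The quotient by the corresponding ideal
has an explicit monomial basis, and its even part has odd dimension, so the commuting
multiplications by `X i * X j` have a common real eigenvector there, from which a real zero is read
off. -/

namespace MvPolynomial

/-! ### Normal forms modulo polynomials whose leading terms are powers of the variables. -/

section LeadingPowers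

variable {σ R : Type*} [CommRing R]

/-- The polynomials all of whose monomials have weight less than `k`. -/
noncomputable def weightLT (R : Type*) [CommRing R] (w : σ → ℕ) (k : ℕ) :
    Submodule R (MvPolynomial σ R) :=
  restrictSupport R {m | Finsupp.weight w m < k}

/-- `p` is the monomial `m` plus terms of smaller weight. -/
def HasLead (w : σ → ℕ) (p : MvPolynomial σ R) (m : σ →₀ ℕ) : Prop :=
  p - monomial m 1 ∈ weightLT R w (Finsupp.weight w m)

theorem weightLT_mono (w : σ → ℕ) {k l : ℕ} (h : k ≤ l) : weightLT R w k ≤ weightLT R w l :=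
  restrictSupport_mono R fun _ hm => lt_of_lt_of_le hm h

theorem monomial_mem_weightLT {w : σ → ℕ} {k : ℕ} {m : σ →₀ ℕ} (c : R)
    (h : Finsupp.weight w m < k) : monomial m c ∈ weightLT R w k := by
  classical
  exact (monomial_mem_restrictSupport R).2 (Or.inl h)

theorem mul_mem_weightLT {w : σ → ℕ} {k l : ℕ} {p q : MvPolynomial σ R}
    (hp : p ∈ weightLT R w k) (hq : q ∈ weightLT R w (l + 1)) : p * q ∈ weightLT R w (k + l) := by
  classical
  intro m hm
  obtain ⟨a, ha, b, hb, rfl⟩ := Finset.mem_add.1 (support_mul p q hm)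
  have h1 : Finsupp.weight w a < k := hp ha
  have h2 : Finsupp.weight w b < l + 1 := hq hb
  simp only [Set.mem_ofPred_eq, map_add]
  omega

theorem HasLead.mem_weightLT {w : σ → ℕ} {p : MvPolynomial σ R} {m : σ →₀ ℕ}
    (h : HasLead w p m) : p ∈ weightLT R w (Finsupp.weight w m + 1) := by
  have h1 := weightLT_mono w (Nat.le_succ _) h
  have h2 : monomial m (1 : R) ∈ weightLT R w (Finsupp.weight w m + 1) :=
    monomial_mem_weightLT 1 (Nat.lt_succ_self _)
  simpa using Submodule.add_mem _ h1 h2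

theorem HasLead.mul {w : σ → ℕ} {p q : MvPolynomial σ R} {m n : σ →₀ ℕ}
    (hp : HasLead w p m) (hq : HasLead w q n) : HasLead w (p * q) (m + n) := by
  have h : p * q - monomial (m + n) 1
      = (p - monomial m 1) * q + (q - monomial n 1) * monomial m 1 := by
    rw [← one_mul (1 : R), ← monomial_mul, one_mul]; ring
  rw [HasLead, h, map_add]
  refine Submodule.add_mem _ (mul_mem_weightLT hp hq.mem_weightLT) ?_
  rw [add_comm]
  exact mul_mem_weightLT hq (monomial_mem_weightLT 1 (Nat.lt_succ_self _))

theorem hasLead_monomial (w : σ → ℕ) (m : σ →₀ ℕ) : HasLead w (monomial m (1 : R)) m := by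
  simp [HasLead]

theorem hasLead_one (w : σ → ℕ) : HasLead w (1 : MvPolynomial σ R) 0 := hasLead_monomial w 0

theorem HasLead.pow {w : σ → ℕ} {p : MvPolynomial σ R} {m : σ →₀ ℕ} (h : HasLead w p m) (n : ℕ) :
    HasLead w (p ^ n) (n • m) := by
  induction n with
  | zero => simpa using hasLead_one w
  | succ n ih => rw [pow_succ, succ_nsmul]; exact ih.mul h

theorem HasLead.prod {ι : Type*} {w : σ → ℕ} {p : ι → MvPolynomial σ R} {m : ι → σ →₀ ℕ}
    (s : Finset ι) (h : ∀ i ∈ s, HasLead w (p i) (m i)) :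
    HasLead w (∏ i ∈ s, p i) (∑ i ∈ s, m i) := by
  classical
  induction s using Finset.induction_on with
  | empty => simpa using hasLead_one w
  | insert a s ha ih =>
    rw [Finset.prod_insert ha, Finset.sum_insert ha]
    exact (h a (Finset.mem_insert_self a s)).mul
      (ih fun i hi => h i (Finset.mem_insert_of_mem hi))

theorem exists_mem_weightLT (w : σ → ℕ) (p : MvPolynomial σ R) : ∃ k, p ∈ weightLT R w k :=
  ⟨p.weightedTotalDegree w + 1, fun _ hm =>
    Nat.lt_succ_of_le (le_weightedTotalDegree w hm)⟩

theorem weightLT_zero_eq (w : σ → ℕ) {p : MvPolynomial σ R} (hp : p ∈ weightLT R w 0) : p = 0 := by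
  rw [← support_eq_empty, Finset.eq_empty_iff_forall_notMem]
  intro m hm
  exact Nat.not_lt_zero _ (hp hm)

variable [Fintype σ]

/-- For the leading monomials `X i ^ d i`, the product of powers of the `F i` and of the variables that has
leading monomial `m`. -/
noncomputable def adicMonomial (F : σ → MvPolynomial σ R) (d : σ → ℕ) (m : σ →₀ ℕ) :
    MvPolynomial σ R :=
  ∏ i, F i ^ (m i / d i) * X i ^ (m i % d i)

/-- The linear map sending each monomial `m` to `adicMonomial F d m`. -/
noncomputable def adicMap (F : σ → MvPolynomial σ R) (d : σ → ℕ) :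
    MvPolynomial σ R →ₗ[R] MvPolynomial σ R :=
  (basisMonomials σ R).constr R (adicMonomial F d)

theorem adicMap_monomial (F : σ → MvPolynomial σ R) (d : σ → ℕ) (m : σ →₀ ℕ) :
    adicMap F d (monomial m 1) = adicMonomial F d m := by
  simpa [adicMap] using (basisMonomials σ R).constr_basis R (adicMonomial F d) m

variable {F : σ → MvPolynomial σ R} {d w : σ → ℕ}

theorem hasLead_adicMonomial (hF : ∀ i, HasLead w (F i) (Finsupp.single i (d i)))
    (m : σ →₀ ℕ) : HasLead w (adicMonomial F d m) m := by
  classical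
  have h : HasLead w (adicMonomial F d m)
      (∑ i, ((m i / d i) • Finsupp.single i (d i) + (m i % d i) • Finsupp.single i 1)) :=
    HasLead.prod _ fun i _ => ((hF i).pow _).mul ((hasLead_monomial w _).pow _)
  convert h using 1
  ext j
  simp [Finsupp.single_apply, Nat.div_add_mod', Finset.sum_add_distrib]

/-- The map is unitriangular for the weight filtration, since each `adicMonomial F d m` has leading
monomial `m`. Induction on the weight then yields bijectivity. -/
theorem sub_adicMap_mem (hF : ∀ i, HasLead w (F i) (Finsupp.single i (d i))) {k : ℕ}
    {p : MvPolynomial σ R} (hp : p ∈ weightLT R w (k + 1)) : p - adicMap F d p ∈ weightLT R w k := by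
  classical
  rw [weightLT, restrictSupport_eq_span] at hp
  induction hp using Submodule.span_induction with
  | mem x hx =>
    obtain ⟨m, hm, rfl⟩ := hx
    have h := hasLead_adicMonomial hF m
    dsimp only
    rw [adicMap_monomial, ← neg_sub]
    exact weightLT_mono w (Nat.lt_succ_iff.1 hm) (Submodule.neg_mem _ h)
  | zero => simp
  | add x y _ _ hx hy =>
    rw [map_add, add_sub_add_comm]
    exact Submodule.add_mem _ hx hy
  | smul a x _ hx =>
    rw [map_smul, ← smul_sub]
    exact Submodule.smul_mem _ _ hx

theorem adicMap_injective (hF : ∀ i, HasLead w (F i) (Finsupp.single i (d i))) :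
    Function.Injective (adicMap F d) := by
  rw [injective_iff_map_eq_zero]
  intro p hp
  obtain ⟨k, hk⟩ := exists_mem_weightLT w p
  induction k with
  | zero => exact weightLT_zero_eq w hk
  | succ k ih => exact ih (by simpa [hp] using sub_adicMap_mem hF hk)

theorem adicMap_surjective (hF : ∀ i, HasLead w (F i) (Finsupp.single i (d i))) :
    Function.Surjective (adicMap F d) := by
  intro p
  obtain ⟨k, hk⟩ := exists_mem_weightLT w p
  induction k generalizing p with
  | zero => exact ⟨0, by rw [weightLT_zero_eq w hk, map_zero]⟩
  | succ k ih =>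
    obtain ⟨q, hq⟩ := ih _ (sub_adicMap_mem hF hk)
    exact ⟨q + p, by rw [map_add, hq]; ring⟩

/-- Multiplying by `X i ^ d i` raises the quotient `m i / d i` by one and keeps the remainder.
Although `adicMap` is not multiplicative, it therefore carries the monomial ideal of the `X i ^ d i`
to the ideal of the `F i`. -/
theorem mul_adicMap (hd : ∀ i, 0 < d i) (i : σ) (p : MvPolynomial σ R) :
    F i * adicMap F d p = adicMap F d (monomial (Finsupp.single i (d i)) 1 * p) := by
  classical
  have h : LinearMap.mulLeft R (F i) ∘ₗ adicMap F d
      = adicMap F d ∘ₗ LinearMap.mulLeft R (monomial (Finsupp.single i (d i)) 1) := by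
    refine (basisMonomials σ R).ext fun m => ?_
    simp only [coe_basisMonomials, LinearMap.comp_apply, LinearMap.mulLeft_apply, monomial_mul,
      one_mul, adicMap_monomial]
    rw [adicMonomial, adicMonomial, ← Finset.mul_prod_erase _ _ (Finset.mem_univ i),
      ← Finset.mul_prod_erase Finset.univ _ (Finset.mem_univ i)]
    have h1 : (Finsupp.single i (d i) + m) i / d i = m i / d i + 1 := by
      simp [Nat.add_div_left _ (hd i)]
    have h2 : (Finsupp.single i (d i) + m) i % d i = m i % d i := by simp
    rw [h1, h2, pow_succ']
    rw [Finset.prod_congr rfl (g := fun x => F x ^ (m x / d x) * X x ^ (m x % d x))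
      (s₁ := Finset.univ.erase i) (f := fun x => F x ^ ((Finsupp.single i (d i) + m) x / d x) *
        X x ^ ((Finsupp.single i (d i) + m) x % d x))]
    · ring
    · intro j hj
      have : (Finsupp.single i (d i) + m) j = m j := by
        simp [Finsupp.single_eq_of_ne (Finset.ne_of_mem_erase hj)]
      rw [this]
  exact LinearMap.congr_fun h p

/-- `adicMap` fixes reduced polynomials, so a reduced element of the ideal already lies in the ideal
generated by the `X i ^ d i`, all of whose monomials are non-reduced. -/
theorem eq_zero_of_mem_span_of_reduced (hd : ∀ i, 0 < d i)
    (hF : ∀ i, HasLead w (F i) (Finsupp.single i (d i))) {p : MvPolynomial σ R}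
    (hp : p ∈ Ideal.span (Set.range F)) (hr : ∀ m ∈ p.support, ∀ i, m i < d i) : p = 0 := by
  classical
  have h1 : adicMap F d p = p := by
    conv_lhs => rw [p.as_sum]
    conv_rhs => rw [p.as_sum]
    rw [map_sum]
    refine Finset.sum_congr rfl fun m hm => ?_
    rw [← mul_one (coeff m p), ← smul_eq_mul, ← smul_monomial, map_smul, adicMap_monomial,
      adicMonomial, monomial_eq, C_1, one_mul, Finsupp.prod_fintype _ _ (by simp)]
    congr 1
    refine Finset.prod_congr rfl fun i _ => ?_
    rw [Nat.div_eq_of_lt (hr m hm i), Nat.mod_eq_of_lt (hr m hm i), pow_zero, one_mul]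
  obtain ⟨c, hc⟩ := Ideal.mem_span_range_iff_exists_fun.1 hp
  choose g hg using fun i => adicMap_surjective hF (c i)
  have h2 : adicMap F d (∑ i, monomial (Finsupp.single i (d i)) 1 * g i) = adicMap F d p := by
    rw [h1, ← hc, map_sum]
    exact Finset.sum_congr rfl fun i _ => by rw [← mul_adicMap hd, hg, mul_comm]
  have h3 := adicMap_injective hF h2
  ext m
  rw [coeff_zero]
  by_contra hm
  have hlt := hr m (mem_support_iff.2 hm)
  apply hm
  rw [← h3, coeff_sum]
  refine Finset.sum_eq_zero fun i _ => ?_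
  rw [coeff_monomial_mul', if_neg]
  intro hle
  have := hle i
  rw [Finsupp.single_eq_same] at this
  exact absurd (hlt i) (not_lt.2 this)

/-- The polynomials all of whose monomials have even degree. -/
noncomputable def evenPart (σ R : Type*) [CommRing R] : Submodule R (MvPolynomial σ R) :=
  restrictSupport R {m | Even m.degree}

/-- The exponents of even degree that are divisible by no power `X i ^ d i`. -/
def evenReduced (d : σ → ℕ) : Set (σ →₀ ℕ) :=
  {m | (∀ i, m i < d i) ∧ Even m.degree}

/-- Modulo `F i`, the power `X i ^ d i` may be replaced by terms of smaller weight. The hypothesis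
`hpar` keeps degrees even during this rewriting. -/
theorem map_evenPart_eq (hF : ∀ i, HasLead w (F i) (Finsupp.single i (d i)))
    (hpar : ∀ i, ∀ m ∈ (F i - monomial (Finsupp.single i (d i)) 1).support, Even (m.degree + d i)) :
    (evenPart σ R).map (Ideal.Quotient.mkₐ R (Ideal.span (Set.range F))).toLinearMap
      = (restrictSupport R (evenReduced d)).map
        (Ideal.Quotient.mkₐ R (Ideal.span (Set.range F))).toLinearMap := by
  classical
  set π := (Ideal.Quotient.mkₐ R (Ideal.span (Set.range F))).toLinearMap with hπ
  apply le_antisymm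
  · rintro _ ⟨p, hp, rfl⟩
    obtain ⟨k, hk⟩ := exists_mem_weightLT w p
    induction k generalizing p with
    | zero => rw [weightLT_zero_eq w hk, map_zero]; exact Submodule.zero_mem _
    | succ k ih =>
      rw [p.as_sum, map_sum]
      refine Submodule.sum_mem _ fun m hm => ?_
      have hev : Even m.degree := hp hm
      have hwt : Finsupp.weight w m < k + 1 := hk hm
      rw [← mul_one (coeff m p), ← smul_eq_mul, ← smul_monomial, map_smul]
      refine Submodule.smul_mem _ _ ?_
      by_cases hred : ∀ i, m i < d i
      · exact ⟨_, (monomial_mem_restrictSupport R).2 (Or.inl ⟨hred, hev⟩), rfl⟩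
      · push Not at hred
        obtain ⟨i, hi⟩ := hred
        obtain ⟨n, rfl⟩ : ∃ n, m = n + Finsupp.single i (d i) :=
          ⟨m - Finsupp.single i (d i), (tsub_add_cancel_of_le (by simpa using hi)).symm⟩
        set q := F i - monomial (Finsupp.single i (d i)) 1 with hq
        have h1 : π (monomial (n + Finsupp.single i (d i)) 1) = π (-(monomial n 1 * q)) := by
          have h2 : monomial (n + Finsupp.single i (d i)) (1 : R)
              = -(monomial n 1 * q) + monomial n 1 * F i := by
            rw [← one_mul (1 : R), ← monomial_mul, one_mul, hq]; ring
          rw [h2, map_add, add_eq_left]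
          exact Ideal.Quotient.eq_zero_iff_mem.2
            (Ideal.mul_mem_left _ _ (Ideal.subset_span ⟨i, rfl⟩))
        rw [h1]
        apply ih
        · refine Submodule.neg_mem _ fun m' hm' => ?_
          obtain ⟨a, ha, b, hb, rfl⟩ := Finset.mem_add.1 (support_mul _ _ hm')
          have ha' : a = n := by simpa using support_monomial_subset ha
          have hb' := hpar i b hb
          subst ha'
          simp only [Set.mem_ofPred_eq, map_add, Finsupp.degree_single] at hev hb' ⊢
          grind
        · refine Submodule.neg_mem _ fun m' hm' => ?_
          obtain ⟨a, ha, b, hb, rfl⟩ := Finset.mem_add.1 (support_mul _ _ hm')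
          have ha' : a = n := by simpa using support_monomial_subset ha
          have hb' : Finsupp.weight w b < Finsupp.weight w (Finsupp.single i (d i)) := hF i hb
          subst ha'
          simp only [Set.mem_ofPred_eq, map_add] at hwt ⊢
          omega
  · exact Submodule.map_mono (restrictSupport_mono R fun m hm => hm.2)

theorem finrank_map_evenPart {K : Type*} [Field K] {F : σ → MvPolynomial σ K}
    (hd : ∀ i, 0 < d i) (hF : ∀ i, HasLead w (F i) (Finsupp.single i (d i)))
    (hpar : ∀ i, ∀ m ∈ (F i - monomial (Finsupp.single i (d i)) 1).support, Even (m.degree + d i)) :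
    Module.finrank K
      ((evenPart σ K).map (Ideal.Quotient.mkₐ K (Ideal.span (Set.range F))).toLinearMap)
      = Nat.card (evenReduced d) := by
  rw [map_evenPart_eq hF hpar]
  set π := (Ideal.Quotient.mkₐ K (Ideal.span (Set.range F))).toLinearMap with hπ
  have hinj : Function.Injective (π ∘ₗ (restrictSupport K (evenReduced d)).subtype) := by
    rw [injective_iff_map_eq_zero]
    rintro ⟨p, hp⟩ h
    have h' : p ∈ Ideal.span (Set.range F) := Ideal.Quotient.eq_zero_iff_mem.1 h
    exact Subtype.ext (eq_zero_of_mem_span_of_reduced hd hF h' fun m hm => (hp hm).1)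
  have h := LinearMap.finrank_range_of_inj hinj
  rw [LinearMap.range_comp, Submodule.range_subtype] at h
  rw [h, Module.finrank_eq_nat_card_basis (basisRestrictSupport K _)]

end LeadingPowers

end MvPolynomial

/-! ### Common eigenvectors of commuting real operators in odd dimension. -/

namespace Module.End

theorem exists_hasEigenvalue_of_odd_finrank {V : Type*} [AddCommGroup V] [Module ℝ V]
    (h : Odd (Module.finrank ℝ V)) (T : Module.End ℝ V) : ∃ c : ℝ, T.HasEigenvalue c := by
  have : Module.Finite ℝ V := Module.finite_of_finrank_pos h.pos
  by_contra! hT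
  have hroot : ∀ y, ¬ T.charpoly.IsRoot y := fun y hy =>
    hT y ((Module.End.hasEigenvalue_iff_isRoot_charpoly T y).2 hy)
  have hlead : 0 ≤ T.charpoly.leadingCoeff := by
    rw [T.charpoly_monic.leadingCoeff]; exact zero_le_one
  -- Without real roots, 0 lies vacuously both to the right and to the left of all roots, and in odd
  -- degree the two resulting signs at 0 disagree.
  have h1 := Polynomial.zero_lt_eval_of_roots_lt_of_leadingCoeff_nonneg (x := 0)
    (fun y hy => absurd hy (hroot y)) hlead
  have h2 := Polynomial.zero_lt_negOnePow_mul_eval_of_lt_roots_of_leadingCoeff_nonneg (x := 0)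
    (fun y hy => absurd hy (hroot y)) hlead
  rw [LinearMap.charpoly_natDegree, Int.negOnePow_odd _ (by exact_mod_cast h)] at h2
  push_cast at h2
  linarith

/-- If some `T i` is not scalar, subtract a real eigenvalue. Kernel and range of the difference are
proper, invariant under all the operators, and their dimensions add up to `n`, so one of them is
odd. -/
theorem exists_common_eigenvector_of_odd_finrank {ι : Type*} (n : ℕ) :
    ∀ {V : Type*} [AddCommGroup V] [Module ℝ V], Module.finrank ℝ V = n → Odd n →
    ∀ T : ι → Module.End ℝ V, (∀ i j, Commute (T i) (T j)) →
    ∃ v : V, v ≠ 0 ∧ ∃ μ : ι → ℝ, ∀ i, T i v = μ i • v := by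
  induction n using Nat.strong_induction_on with
  | _ n ih =>
    intro V _ _ hn hodd T hT
    have hfin : Module.Finite ℝ V := Module.finite_of_finrank_pos (hn ▸ hodd.pos)
    have restrict : ∀ W : Submodule ℝ V, Module.finrank ℝ W < n → Odd (Module.finrank ℝ W) →
        (∀ i, ∀ x ∈ W, T i x ∈ W) → ∃ v : V, v ≠ 0 ∧ ∃ μ : ι → ℝ, ∀ i, T i v = μ i • v := by
      intro W hlt hW hinv
      obtain ⟨v, hv, μ, h⟩ := ih _ hlt rfl hW (fun i => (T i).restrict (hinv i)) fun i j =>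
        LinearMap.ext fun x => Subtype.ext (LinearMap.congr_fun (hT i j) x)
      exact ⟨v, by simpa using hv, μ, fun i => congrArg Subtype.val (h i)⟩
    by_cases hs : ∀ i, ∃ c : ℝ, ∀ x, T i x = c • x
    · choose μ hμ using hs
      have : Nontrivial V := Module.nontrivial_of_finrank_pos (R := ℝ) (hn ▸ hodd.pos)
      obtain ⟨v, hv⟩ := exists_ne (0 : V)
      exact ⟨v, hv, μ, fun i => hμ i v⟩
    · push Not at hs
      obtain ⟨i, hi⟩ := hs
      obtain ⟨c, hc⟩ := exists_hasEigenvalue_of_odd_finrank (hn ▸ hodd) (T i)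
      set S : Module.End ℝ V := T i - algebraMap ℝ _ c with hS
      have hcomm : ∀ j x, S (T j x) = T j (S x) := by
        intro j x
        have := LinearMap.congr_fun (hT i j) x
        simp only [Module.End.mul_apply] at this
        simp [hS, this]
      have hsum := S.finrank_range_add_finrank_ker
      have hkpos : 0 < Module.finrank ℝ (LinearMap.ker S) := by
        obtain ⟨v, hv⟩ := hc.exists_hasEigenvector
        have : Nontrivial (LinearMap.ker S) :=
          ⟨⟨⟨v, by simp [hS, hv.apply_eq_smul]⟩, 0, fun h => hv.2 (congrArg Subtype.val h)⟩⟩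
        exact Module.finrank_pos
      have hrpos : 0 < Module.finrank ℝ (LinearMap.range S) := by
        obtain ⟨x, hx⟩ := hi c
        have : Nontrivial (LinearMap.range S) := by
          refine ⟨⟨⟨S x, x, rfl⟩, 0, fun h => hx ?_⟩⟩
          have h' : S x = 0 := congrArg Subtype.val h
          simpa [hS, sub_eq_zero] using h'
        exact Module.finrank_pos
      rw [hn] at hsum
      rcases Nat.even_or_odd (Module.finrank ℝ (LinearMap.ker S)) with he | ho
      · refine restrict (LinearMap.range S) (by omega) (by grind) ?_
        rintro j _ ⟨x, rfl⟩
        exact ⟨T j x, hcomm j x⟩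
      · refine restrict (LinearMap.ker S) (by omega) ho ?_
        intro j x hx
        rw [LinearMap.mem_ker] at hx ⊢
        rw [hcomm, hx, map_zero]

end Module.End

/-! ### Real zeros from an even part of odd dimension. -/

namespace MvPolynomial

theorem mul_mem_evenPart {σ R : Type*} [CommRing R] {p q : MvPolynomial σ R}
    (hp : p ∈ evenPart σ R) (hq : q ∈ evenPart σ R) : p * q ∈ evenPart σ R := by
  classical
  intro m hm
  obtain ⟨a, ha, b, hb, rfl⟩ := Finset.mem_add.1 (support_mul p q hm)
  have h1 : Even a.degree := hp ha
  have h2 : Even b.degree := hq hb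
  simp only [Set.mem_ofPred_eq, map_add]
  exact h1.add h2

theorem monomial_mem_evenPart {σ R : Type*} [CommRing R] {m : σ →₀ ℕ} (h : Even m.degree) (c : R) :
    monomial m c ∈ evenPart σ R := by
  classical
  exact (monomial_mem_restrictSupport R).2 (Or.inl h)

theorem X_mul_X_mem_evenPart {σ R : Type*} [CommRing R] (i j : σ) :
    (X i * X j : MvPolynomial σ R) ∈ evenPart σ R := by
  rw [X, X, monomial_mul]
  exact monomial_mem_evenPart (by simp) _

/-- If the image of the even polynomials in the quotient by an ideal `I` has odd dimension and
the sum of the squares of the variables is `1` modulo `I`, then `I` has a real zero. -/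
theorem exists_forall_mem_eval_eq_zero {σ : Type*} [Fintype σ] {I : Ideal (MvPolynomial σ ℝ)}
    (hI : ∑ i, X i ^ 2 - 1 ∈ I)
    (hodd : Odd (Module.finrank ℝ ((evenPart σ ℝ).map (Ideal.Quotient.mkₐ ℝ I).toLinearMap))) :
    ∃ c : σ → ℝ, ∀ p ∈ I, eval c p = 0 := by
  set π := Ideal.Quotient.mkₐ ℝ I with hπ
  set W := (evenPart σ ℝ).map π.toLinearMap with hW
  have hinv : ∀ ij : σ × σ, ∀ x ∈ W, LinearMap.mulLeft ℝ (π (X ij.1 * X ij.2)) x ∈ W := by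
    rintro ⟨i, j⟩ _ ⟨p, hp, rfl⟩
    exact ⟨X i * X j * p, mul_mem_evenPart (X_mul_X_mem_evenPart i j) hp, by simp [mul_assoc]⟩
  obtain ⟨⟨w, hwW⟩, hw0, μ, hμ⟩ := Module.End.exists_common_eigenvector_of_odd_finrank
    _ rfl hodd (fun ij : σ × σ => (LinearMap.mulLeft ℝ (π (X ij.1 * X ij.2))).restrict (hinv ij))
    (fun ij kl => LinearMap.ext fun x => Subtype.ext (by
      simp only [Module.End.mul_apply, LinearMap.coe_restrict_apply, LinearMap.mulLeft_apply]
      ring))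
  have hw : w ≠ 0 := fun h => hw0 (Subtype.ext h)
  have hμ' : ∀ i j, π (X i) * π (X j) * w = μ (i, j) • w := fun i j => by
    simpa [mul_assoc] using congrArg Subtype.val (hμ (i, j))
  clear hμ
  have hsum : ∑ i, μ (i, i) = 1 := by
    have h1 : π (∑ i, X i ^ 2) = 1 := by
      rw [← map_one π]
      exact Ideal.Quotient.eq.2 hI
    have h2 : (∑ i, μ (i, i)) • w = (1 : ℝ) • w := by
      rw [Finset.sum_smul, one_smul]
      conv_rhs => rw [← one_mul w, ← h1, map_sum, Finset.sum_mul]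
      exact Finset.sum_congr rfl fun i _ => by rw [← hμ', map_pow, sq]
    exact smul_left_injective ℝ hw h2
  -- The eigenvalues of the squares sum to 1, so some `X a ^ 2` has a positive eigenvalue and hence
  -- a real square root `s`.
  obtain ⟨a, ha⟩ : ∃ a, 0 < μ (a, a) := by
    by_contra! h
    have := Finset.sum_nonpos fun i (_ : i ∈ Finset.univ) => h i
    linarith
  set s := √(μ (a, a)) with hs
  have hs0 : 0 < s := Real.sqrt_pos.2 ha
  have hss : s * s = μ (a, a) := Real.mul_self_sqrt ha.le
  set w' := π (X a) * w with hw'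
  have h1 : ∀ j, π (X j) * w' = μ (j, a) • w := fun j => by rw [hw', ← mul_assoc, hμ']
  have h2 : ∀ j, π (X j) * w = (μ (j, a) / (s * s)) • w' := by
    intro j
    have h3 : (s * s) • (π (X j) * w) = μ (j, a) • w' := by
      rw [hss, ← mul_smul_comm, ← hμ', hw', ← mul_smul_comm, ← hμ']
      ring
    rw [div_eq_inv_mul, mul_smul, ← h3, smul_smul, inv_mul_cancel₀ (by positivity), one_smul]
  -- Multiplication by `X a` sends `w` to `w'` and `w'` to `s ^ 2 • w`. So `w' + s • w` is an
  -- eigenvector of every `X j`, unless it vanishes, in which case `w` itself is one.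
  obtain ⟨u, hu, c, hc⟩ : ∃ u : MvPolynomial σ ℝ ⧸ I, u ≠ 0 ∧ ∃ c : σ → ℝ,
      ∀ j, π (X j) * u = c j • u := by
    by_cases h : w' + s • w = 0
    · refine ⟨w, hw, fun j => -(μ (j, a) / s), fun j => ?_⟩
      rw [h2, eq_neg_of_add_eq_zero_left h, smul_neg, smul_smul, neg_smul]
      congr 2
      field_simp
    · refine ⟨w' + s • w, h, fun j => μ (j, a) / s, fun j => ?_⟩
      rw [mul_add, mul_smul_comm, h1, h2, smul_add, smul_smul, smul_smul, add_comm]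
      congr 2 <;> field_simp
  refine ⟨c, fun p hp => ?_⟩
  have key : ∀ p, π p * u = eval c p • u := by
    intro p
    induction p using MvPolynomial.induction_on with
    | C r =>
      rw [eval_C, ← algebraMap_eq, AlgHom.commutes]
      exact (Algebra.smul_def r u).symm
    | add p q hp hq => rw [map_add, add_mul, hp, hq, map_add, add_smul]
    | mul_X p i hp =>
      rw [map_mul, mul_assoc, hc, mul_smul_comm, hp, smul_smul, map_mul, eval_X, mul_comm]
  have h3 := key p
  rw [show π p = 0 from Ideal.Quotient.eq_zero_iff_mem.2 hp, zero_mul] at h3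
  exact (smul_eq_zero.1 h3.symm).resolve_right hu

/-- The exponent of the first variable is 0 or 1 and is determined by the parity of the others. -/
theorem card_evenReduced (n d : ℕ) :
    Nat.card (evenReduced (Fin.cons 2 fun _ => d : Fin (n + 1) → ℕ)) = d ^ n := by
  have hb : Function.Bijective (fun (m : evenReduced (Fin.cons 2 fun _ => d : Fin (n + 1) → ℕ))
      (i : Fin n) => (⟨m.1 i.succ, by simpa using m.2.1 i.succ⟩ : Fin d)) := by
    constructor
    · rintro ⟨m, hm⟩ ⟨m', hm'⟩ h
      have h1 : ∀ i : Fin n, m i.succ = m' i.succ := fun i => by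
        simpa using congrFun h i
      have h0 : m 0 < 2 := by simpa using hm.1 0
      have h0' : m' 0 < 2 := by simpa using hm'.1 0
      have he := hm.2
      have he' := hm'.2
      rw [Finsupp.degree_eq_sum, Fin.sum_univ_succ] at he he'
      rw [Finset.sum_congr rfl fun i _ => h1 i] at he
      refine Subtype.ext (Finsupp.ext fun i => ?_)
      refine Fin.cases ?_ h1 i
      grind
    · intro e
      refine ⟨⟨Finsupp.equivFunOnFinite.symm
        (Fin.cons ((∑ i, (e i : ℕ)) % 2) fun i => (e i : ℕ)), ?_, ?_⟩, ?_⟩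
      · intro i
        refine Fin.cases ?_ (fun j => ?_) i
        · simpa using Nat.mod_lt _ two_pos
        · simp
      · rw [Finsupp.degree_eq_sum, Fin.sum_univ_succ]
        simp only [Finsupp.equivFunOnFinite_symm_apply_apply, Fin.cons_zero, Fin.cons_succ]
        grind
      · ext i
        simp
  rw [Nat.card_congr (Equiv.ofBijective _ hb)]
  simp

/-- Odd polynomials, perturbed by a sufficiently high odd power of a variable each, have a common
zero on the unit sphere. -/
theorem exists_sphere_pow_add_eval_eq_zero {n : ℕ} (q : Fin n → MvPolynomial (Fin (n + 1)) ℝ)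
    (hq : ∀ i, ∀ m ∈ (q i).support, Odd m.degree) :
    ∃ (d : ℕ) (c : Fin (n + 1) → ℝ), ∑ i, c i ^ 2 = 1 ∧
      ∀ i, c i.succ ^ d + eval c (q i) = 0 := by
  classical
  -- Giving the first variable weight 2 makes `X 0 ^ 2` the leading term of the sphere equation. The
  -- exponent `2 * N + 1` exceeds the weights in every `q i`, and being odd it makes the even part
  -- of dimension `(2 * N + 1) ^ n` odd.
  set w : Fin (n + 1) → ℕ := Fin.cons 2 fun _ => 1 with hw
  set N := Finset.univ.sup fun i => (q i).weightedTotalDegree w with hN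
  set e : Fin (n + 1) → ℕ := Fin.cons 2 fun _ => 2 * N + 1 with he
  set r : Fin (n + 1) → MvPolynomial (Fin (n + 1)) ℝ :=
    Fin.cons (∑ i : Fin n, X i.succ ^ 2 - 1) q with hr
  set F : Fin (n + 1) → MvPolynomial (Fin (n + 1)) ℝ :=
    fun i => monomial (Finsupp.single i (e i)) 1 + r i with hFdef
  have hpos : ∀ i, 0 < e i := fun i => by
    refine Fin.cases ?_ (fun j => ?_) i <;> simp [he]
  have hF : ∀ i, HasLead w (F i) (Finsupp.single i (e i)) := by
    intro i
    rw [HasLead, hFdef, add_sub_cancel_left]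
    refine Fin.cases ?_ (fun j => ?_) i
    · simp only [hr, Fin.cons_zero]
      refine Submodule.sub_mem _ (Submodule.sum_mem _ fun j _ => ?_)
        (monomial_mem_weightLT 1 (by simp [he, hw, Finsupp.weight_single]))
      rw [X_pow_eq_monomial]
      exact monomial_mem_weightLT 1 (by simp [he, hw, Finsupp.weight_single])
    · simp only [hr, Fin.cons_succ]
      intro m hm
      have h1 : Finsupp.weight w m ≤ (q j).weightedTotalDegree w := le_weightedTotalDegree w hm
      have h2 : (q j).weightedTotalDegree w ≤ N :=
        Finset.le_sup (f := fun i => (q i).weightedTotalDegree w) (Finset.mem_univ j)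
      have h3 : Finsupp.weight w (Finsupp.single j.succ (e j.succ)) = 2 * N + 1 := by
        rw [Finsupp.weight_single]
        simp [he, hw]
      rw [Set.mem_ofPred_eq, h3]
      omega
  have hpar : ∀ i, ∀ m ∈ (F i - monomial (Finsupp.single i (e i)) 1).support,
      Even (m.degree + e i) := by
    intro i
    rw [hFdef, add_sub_cancel_left]
    refine Fin.cases ?_ (fun j => ?_) i
    · have h : ∑ i : Fin n, X i.succ ^ 2 - 1 ∈ evenPart (Fin (n + 1)) ℝ := by
        refine Submodule.sub_mem _ (Submodule.sum_mem _ fun j _ => ?_)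
          (monomial_mem_evenPart (by simp) 1)
        rw [sq]
        exact X_mul_X_mem_evenPart _ _
      intro m hm
      have h' : Even m.degree := h hm
      simpa [he] using h'.add even_two
    · intro m hm
      simp only [hr, Fin.cons_succ] at hm
      simp only [he, Fin.cons_succ]
      exact (hq j m hm).add_odd ⟨N, rfl⟩
  obtain ⟨c, hc⟩ := exists_forall_mem_eval_eq_zero (I := Ideal.span (Set.range F))
    (by
      convert Ideal.subset_span (Set.mem_range_self (f := F) 0) using 1
      rw [Fin.sum_univ_succ, X_pow_eq_monomial]
      simp [hFdef, hr, he, add_sub_assoc])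
    (by
      rw [finrank_map_evenPart hpos hF hpar, he, card_evenReduced]
      exact Odd.pow ⟨N, rfl⟩)
  have hc' : ∀ i, eval c (F i) = 0 := fun i => hc _ (Ideal.subset_span ⟨i, rfl⟩)
  refine ⟨2 * N + 1, c, ?_, fun i => ?_⟩
  · have h := hc' 0
    simp only [hFdef, hr, he, Fin.cons_zero, map_add, eval_monomial, map_sub, map_sum, map_pow,
      eval_X, map_one, one_mul] at h
    rw [Fin.sum_univ_succ]
    simp at h
    linarith
  · have h := hc' i.succ
    simpa [hFdef, hr, he, ← X_pow_eq_monomial] using h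

end MvPolynomial

/-! ### The odd part of a polynomial. -/

namespace MvPolynomial

/-- The sum of the terms of odd degree. -/
noncomputable def oddTerms {σ R : Type*} [CommSemiring R] (p : MvPolynomial σ R) :
    MvPolynomial σ R :=
  ∑ m ∈ p.support with Odd m.degree, monomial m (coeff m p)

theorem odd_degree_of_mem_support_oddTerms {σ R : Type*} [CommSemiring R] {p : MvPolynomial σ R}
    {m : σ →₀ ℕ} (hm : m ∈ p.oddTerms.support) : Odd m.degree := by
  classical
  obtain ⟨a, ha, h⟩ := Finset.mem_biUnion.1 (support_sum hm)
  rw [Finset.mem_singleton.1 (support_monomial_subset h)]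
  exact (Finset.mem_filter.1 ha).2

theorem eval_neg_monomial {σ R : Type*} [CommRing R] (x : σ → R) (m : σ →₀ ℕ) (c : R) :
    eval (-x) (monomial m c) = (-1) ^ m.degree * eval x (monomial m c) := by
  simp only [eval_monomial, Pi.neg_apply, Finsupp.prod, Finsupp.degree_apply]
  rw [← Finset.prod_pow_eq_pow_sum, mul_left_comm, ← Finset.prod_mul_distrib]
  congr 1
  exact Finset.prod_congr rfl fun i _ => neg_pow _ _

theorem eval_sub_eval_neg {σ R : Type*} [CommRing R] (p : MvPolynomial σ R) (x : σ → R) :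
    eval x p - eval (-x) p = 2 * eval x p.oddTerms := by
  conv_lhs => rw [p.as_sum, map_sum, map_sum, ← Finset.sum_sub_distrib]
  rw [oddTerms, map_sum, Finset.mul_sum, Finset.sum_filter]
  refine Finset.sum_congr rfl fun m _ => ?_
  rw [eval_neg_monomial]
  split_ifs with h
  · rw [h.neg_one_pow]; ring
  · rw [(Nat.not_odd_iff_even.1 h).neg_one_pow]; ring

end MvPolynomial

/-! ### The Borsuk–Ulam theorem and a version for rays. -/

section BorsukUlam

open Metric

theorem exists_mvPolynomial_near {ι : Type*} [Fintype ι] {S : Set (EuclideanSpace ℝ ι)}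
    [CompactSpace S] (f : C(S, ℝ)) {δ : ℝ} (hδ : 0 < δ) :
    ∃ p : MvPolynomial ι ℝ, ∀ x : S, |MvPolynomial.eval (fun i => x.1 i) p - f x| < δ := by
  set coord : ι → C(S, ℝ) := fun i => ⟨fun x => x.1 i, by fun_prop⟩ with hcoord
  have hsep : (MvPolynomial.aeval (R := ℝ) coord).range.SeparatesPoints := by
    intro x y hxy
    obtain ⟨i, hi⟩ : ∃ i, x.1 i ≠ y.1 i := by
      by_contra! h
      exact hxy (Subtype.ext (PiLp.ext h))
    exact ⟨coord i, ⟨coord i, ⟨MvPolynomial.X i, MvPolynomial.aeval_X _ _⟩, rfl⟩, hi⟩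
  obtain ⟨⟨_, p, rfl⟩, hp⟩ :=
    ContinuousMap.exists_mem_subalgebra_near_continuous_of_separatesPoints _ hsep f f.continuous
      δ hδ
  refine ⟨p, fun x => ?_⟩
  have h : (MvPolynomial.aeval coord p : C(S, ℝ)) x = MvPolynomial.eval (fun i => x.1 i) p := by
    have := MvPolynomial.comp_aeval_apply (R := ℝ) (f := coord) (ContinuousMap.evalAlgHom ℝ ℝ x) p
    rw [← MvPolynomial.coe_aeval_eq_eval]
    exact this
  rw [← h]
  exact hp x

/-- The exponent `d` is not controlled, but coordinates on the sphere are at most 1 in absolute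
value. Scaling the odd parts by `δ⁻¹` beforehand makes the perturbation cost at most `δ`;
approximating the odd function `h` costs less than another `δ`. -/
theorem exists_norm_sub_neg_lt {n : ℕ}
    (g : C(sphere (0 : EuclideanSpace ℝ (Fin (n + 1))) 1, Fin n → ℝ)) {δ : ℝ} (hδ : 0 < δ) :
    ∃ x, ‖g x - g (-x)‖ < 2 * δ := by
  set h : C(sphere (0 : EuclideanSpace ℝ (Fin (n + 1))) 1, Fin n → ℝ) :=
    ⟨fun x => g x - g (-x), by fun_prop⟩ with hh
  choose p hp using fun i => exists_mvPolynomial_near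
    (⟨fun x => h x i, by fun_prop⟩ : C(sphere (0 : EuclideanSpace ℝ (Fin (n + 1))) 1, ℝ)) hδ
  obtain ⟨d, c, hc1, hc⟩ := MvPolynomial.exists_sphere_pow_add_eval_eq_zero
    (fun i => δ⁻¹ • (p i).oddTerms) fun i m hm =>
      MvPolynomial.odd_degree_of_mem_support_oddTerms (MvPolynomial.support_smul hm)
  set x : sphere (0 : EuclideanSpace ℝ (Fin (n + 1))) 1 :=
    ⟨WithLp.toLp 2 c, by rw [mem_sphere_zero_iff_norm, EuclideanSpace.norm_eq]; simp [hc1]⟩ with hx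
  refine ⟨x, (pi_norm_lt_iff (by positivity)).2 fun i => ?_⟩
  have h1 := hp i x
  have h2 := hp i (-x)
  have h3 := MvPolynomial.eval_sub_eval_neg (p i) c
  have h4 := hc i
  have h5 : |c i.succ ^ d| ≤ 1 := by
    rw [abs_pow]
    refine pow_le_one₀ (abs_nonneg _) ?_
    rw [← sq_le_one_iff_abs_le_one, ← hc1]
    exact Finset.single_le_sum (f := fun i => c i ^ 2) (fun i _ => sq_nonneg _)
      (Finset.mem_univ _)
  have h6 : |MvPolynomial.eval c (p i).oddTerms| ≤ δ := by
    rw [MvPolynomial.smul_eval] at h4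
    have : MvPolynomial.eval c (p i).oddTerms = -(δ * c i.succ ^ d) := by
      field_simp at h4
      linarith
    rw [this, abs_neg, abs_mul, abs_of_pos hδ]
    exact mul_le_of_le_one_right hδ.le h5
  have h7 : (fun j => (-x).1 j) = -c := by
    ext j; simp [hx]
  have h8 : (fun j => x.1 j) = c := rfl
  simp only [ContinuousMap.coe_mk, h7, h8] at h1 h2
  have h9 : h (-x) i = -h x i := by simp [hh]
  rw [h9] at h2
  change ‖h x i‖ < _
  rw [Real.norm_eq_abs, abs_lt]
  rw [abs_lt] at h1 h2
  rw [abs_le] at h6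
  constructor <;> linarith

/-- The **Borsuk–Ulam theorem**: a continuous map from the `n`-sphere to `ℝⁿ` identifies some pair
of antipodal points. -/
theorem borsuk_ulam {n : ℕ}
    (g : C(sphere (0 : EuclideanSpace ℝ (Fin (n + 1))) 1, Fin n → ℝ)) : ∃ x, g x = g (-x) := by
  have : Nonempty (sphere (0 : EuclideanSpace ℝ (Fin (n + 1))) 1) :=
    (NormedSpace.sphere_nonempty.2 zero_le_one).to_subtype
  obtain ⟨x, -, hx⟩ := isCompact_univ.exists_isMinOn Set.univ_nonempty
    (show Continuous fun x => ‖g x - g (-x)‖ by fun_prop).continuousOn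
  refine ⟨x, sub_eq_zero.1 (norm_le_zero_iff.1 (le_of_forall_pos_le_add fun δ hδ => ?_))⟩
  obtain ⟨y, hy⟩ := exists_norm_sub_neg_lt g (half_pos hδ)
  have := hx (Set.mem_univ y)
  simp only [Set.mem_ofPred_eq] at this
  linarith

open scoped InnerProductSpace

/-- A continuous map from the `n`-sphere to an `(n + 1)`-dimensional space either meets a given ray
or sends some pair of antipodal points to the same ray. -/
theorem exists_sameRay_or_sameRay_neg {n : ℕ} {E : Type*} [NormedAddCommGroup E]
    [InnerProductSpace ℝ E] [Fact (Module.finrank ℝ E = n + 1)]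
    (W : C(sphere (0 : EuclideanSpace ℝ (Fin (n + 1))) 1, E)) (v : E) :
    (∃ u, SameRay ℝ (W u) v) ∨ ∃ u, SameRay ℝ (W u) (W (-u)) := by
  have : Nonempty (sphere (0 : EuclideanSpace ℝ (Fin (n + 1))) 1) :=
    (NormedSpace.sphere_nonempty.2 zero_le_one).to_subtype
  have : FiniteDimensional ℝ E := .of_fact_finrank_eq_succ n
  rw [or_iff_not_imp_left]
  intro hW
  push Not at hW
  rcases eq_or_ne v 0 with rfl | hv
  · exact absurd (SameRay.zero_right _) (hW (Classical.arbitrary _))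
  -- Every ray other than that of `v` meets the paraboloid `‖p‖ * ‖v‖ - ⟪p, v⟫ = 1` exactly once,
  -- and projection to `vᗮ` is injective on it. Borsuk–Ulam is applied to the `n` coordinates of
  -- this projection.
  have ha : ∀ u, 0 < ‖W u‖ * ‖v‖ - ⟪W u, v⟫_ℝ := fun u =>
    sub_pos.2 (lt_of_le_of_ne (real_inner_le_norm _ _) fun h =>
      hW u (sameRay_iff_norm_smul_eq.2 (by rw [← inner_eq_norm_mul_iff_real.1 h])))
  have hrank : Module.finrank ℝ (ℝ ∙ v)ᗮ = n := Submodule.finrank_orthogonal_span_singleton hv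
  set b := (stdOrthonormalBasis ℝ (ℝ ∙ v)ᗮ).reindex (finCongr hrank) with hb
  have hcont : Continuous fun u (i : Fin n) =>
      ⟪(b i : E), W u⟫_ℝ / (‖W u‖ * ‖v‖ - ⟪W u, v⟫_ℝ) :=
    continuous_pi fun i => (by fun_prop : Continuous fun u => ⟪(b i : E), W u⟫_ℝ).div
      (by fun_prop) fun u => (ha u).ne'
  obtain ⟨u, hu⟩ := borsuk_ulam ⟨_, hcont⟩
  refine ⟨u, ?_⟩
  set s := ‖W u‖ * ‖v‖ - ⟪W u, v⟫_ℝ with hs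
  set s' := ‖W (-u)‖ * ‖v‖ - ⟪W (-u), v⟫_ℝ with hs'
  have hs0 : 0 < s := ha u
  have hs0' : 0 < s' := ha (-u)
  set p := s⁻¹ • W u with hp
  set p' := s'⁻¹ • W (-u) with hp'
  have hp1 : ‖p‖ * ‖v‖ - ⟪p, v⟫_ℝ = 1 := by
    rw [hp, norm_smul, real_inner_smul_left, Real.norm_of_nonneg (inv_pos.2 hs0).le, mul_assoc,
      ← mul_sub, ← hs, inv_mul_cancel₀ hs0.ne']
  have hp1' : ‖p'‖ * ‖v‖ - ⟪p', v⟫_ℝ = 1 := by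
    rw [hp', norm_smul, real_inner_smul_left, Real.norm_of_nonneg (inv_pos.2 hs0').le, mul_assoc,
      ← mul_sub, ← hs', inv_mul_cancel₀ hs0'.ne']
  have hperp : p' - p ∈ (ℝ ∙ v)ᗮᗮ := by
    rw [Submodule.mem_orthogonal]
    intro y hy
    have hsum := congrArg Subtype.val (b.sum_repr ⟨y, hy⟩)
    simp only [Submodule.coe_sum, Submodule.coe_smul] at hsum
    rw [← hsum, sum_inner]
    refine Finset.sum_eq_zero fun i _ => ?_
    have hi := congrFun hu i
    simp only [ContinuousMap.coe_mk, ← hs, ← hs'] at hi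
    rw [real_inner_smul_left, inner_sub_right, hp, hp', real_inner_smul_right,
      real_inner_smul_right, inv_mul_eq_div, inv_mul_eq_div, hi, sub_self, mul_zero]
  clear_value p p'
  rw [Submodule.orthogonal_orthogonal, Submodule.mem_span_singleton] at hperp
  obtain ⟨c, hc⟩ := hperp
  have hp'eq : p' = p + c • v := by rw [hc]; abel
  have hv0 : 0 < ‖v‖ := norm_pos_iff.2 hv
  have hnorm : ‖p'‖ = ‖p‖ + c * ‖v‖ := by
    have h : ⟪p', v⟫_ℝ = ⟪p, v⟫_ℝ + c * ‖v‖ ^ 2 := by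
      rw [hp'eq, inner_add_left, real_inner_smul_left, real_inner_self_eq_norm_sq]
    have h2 : ‖p'‖ * ‖v‖ = (‖p‖ + c * ‖v‖) * ‖v‖ := by linarith
    exact mul_right_cancel₀ hv0.ne' h2
  have hsq : ‖p'‖ ^ 2 = ‖p‖ ^ 2 + 2 * (c * ⟪p, v⟫_ℝ) + c ^ 2 * ‖v‖ ^ 2 := by
    rw [hp'eq, norm_add_sq_real, real_inner_smul_right, norm_smul, mul_pow, Real.norm_eq_abs,
      sq_abs]
  have hc0 : c = 0 := by
    rw [hnorm] at hsq
    linear_combination (1 / 2) * hsq - c * hp1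
  rw [hc0, zero_smul, add_zero] at hp'eq
  exact Or.inr (Or.inr ⟨s⁻¹, s'⁻¹, inv_pos.2 hs0, inv_pos.2 hs0', by rw [← hp, ← hp', hp'eq]⟩)

end BorsukUlam

/-! ### From Gromov–Hausdorff distance to maps of small distortion. -/

/-- A map distorting distances by at most `δ`. -/
def DistortionLE {A : Type u} {B : Type v} [MetricSpace A] [MetricSpace B] (f : B → A) (δ : ℝ) :
    Prop :=
  ∀ b b', |dist (f b) (f b') - dist b b'| ≤ δ

theorem exists_distortionLE_of_hausdorffEDist_lt {A B Z : Type*} [MetricSpace A] [MetricSpace B]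
    [MetricSpace Z] {φ : A → Z} {ψ : B → Z} (hφ : Isometry φ) (hψ : Isometry ψ) {ε : ℝ}
    (h : Metric.hausdorffEDist (Set.range φ) (Set.range ψ) < ENNReal.ofReal (ε / 2)) :
    (∃ δ < ε, ∃ f : B → A, DistortionLE f δ) ∧ ∃ δ < ε, ∃ f : A → B, DistortionLE f δ := by
  obtain ⟨e, he1, he2⟩ := exists_between h
  have htop : e ≠ ∞ := he2.ne_top
  have hlt : 2 * e.toReal < ε := by
    have := (ENNReal.lt_ofReal_iff_toReal_lt htop).1 he2
    linarith
  constructor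
  · rw [Metric.hausdorffEDist_comm] at he1
    have hex : ∀ b, ∃ a, dist (ψ b) (φ a) < e.toReal := fun b => by
      obtain ⟨_, ⟨a, rfl⟩, ha⟩ :=
        Metric.exists_edist_lt_of_hausdorffEDist_lt (Set.mem_range_self b) he1
      exact ⟨a, by rwa [edist_dist, ENNReal.ofReal_lt_iff_lt_toReal dist_nonneg htop] at ha⟩
    choose f hf using hex
    refine ⟨_, hlt, f, fun b b' => ?_⟩
    have h1 := hf b
    have h2 := hf b'
    rw [← hφ.dist_eq, ← hψ.dist_eq, ← Real.dist_eq, dist_comm]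
    exact (dist_dist_dist_le _ _ _ _).trans (by linarith)
  · have hex : ∀ a, ∃ b, dist (φ a) (ψ b) < e.toReal := fun a => by
      obtain ⟨_, ⟨b, rfl⟩, hb⟩ :=
        Metric.exists_edist_lt_of_hausdorffEDist_lt (Set.mem_range_self a) he1
      exact ⟨b, by rwa [edist_dist, ENNReal.ofReal_lt_iff_lt_toReal dist_nonneg htop] at hb⟩
    choose f hf using hex
    refine ⟨_, hlt, f, fun a a' => ?_⟩
    have h1 := hf a
    have h2 := hf a'
    rw [← hφ.dist_eq, ← hψ.dist_eq, ← Real.dist_eq, dist_comm]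
    exact (dist_dist_dist_le _ _ _ _).trans (by linarith)

theorem exists_distortionLE_of_pointedGHDist_lt {A : Type u} {B : Type v} [MetricSpace A]
    [MetricSpace B] {p : A} {q : B} {ε : ℝ} (h : pointedGHDist p q < ENNReal.ofReal (ε / 2)) :
    (∃ δ < ε, ∃ f : B → A, DistortionLE f δ) ∧ ∃ δ < ε, ∃ f : A → B, DistortionLE f δ := by
  simp only [pointedGHDist, iInf_lt_iff] at h
  obtain ⟨Z, _, φ, ψ, hφ, hψ, h⟩ := h
  exact exists_distortionLE_of_hausdorffEDist_lt hφ hψ ((le_max_left _ _).trans_lt h)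

/-! ### The distance estimate in `ℝ^k × X`. -/

namespace EuclideanProd

theorem dist_sq_eq {k : ℕ} {X : Type u} [MetricSpace X] (z z' : EuclideanProd k X) :
    dist z z' ^ 2 = dist z.fst z'.fst ^ 2 + dist z.snd z'.snd ^ 2 := by
  rw [WithLp.prod_dist_eq_add (by norm_num)]
  simp only [ENNReal.toReal_ofNat, Real.rpow_ofNat]
  rw [← Real.sqrt_eq_rpow, Real.sq_sqrt (by positivity)]

theorem dist_le_add {k : ℕ} {X : Type u} [MetricSpace X] (z z' : EuclideanProd k X) :
    dist z z' ≤ dist z.fst z'.fst + dist z.snd z'.snd := by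
  refine abs_le_of_sq_le_sq' ?_ (by positivity) |>.2
  rw [dist_sq_eq]
  nlinarith [mul_nonneg (dist_nonneg (x := z.fst) (y := z'.fst))
    (dist_nonneg (x := z.snd) (y := z'.snd))]

theorem norm_fst_le {k : ℕ} {X : Type u} [MetricSpace X] {x : X} {R : ℝ}
    (z : Metric.closedBall (base k x) R) : ‖z.1.fst‖ ≤ R := by
  have h : dist z.1.fst (base k x).fst ≤ dist z.1 (base k x) := WithLp.dist_fst_le _ _
  rw [← dist_zero_right]
  exact h.trans z.2

/-- The point `(R u, y)` of the ball of radius `R` around `(0, y)`. -/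
noncomputable def spherePoint {k : ℕ} {Y : Type v} [MetricSpace Y] (y : Y) {R : ℝ} (hR : 0 ≤ R)
    (u : Metric.sphere (0 : EuclideanSpace ℝ (Fin k)) 1) : Metric.closedBall (base k y) R :=
  ⟨WithLp.toLp 2 (R • u.1, y), by
    refine (dist_le_add _ _).trans ?_
    simp [base, norm_smul, abs_of_nonneg hR]⟩

/-- The point `(0, y)` of the ball of radius `R` around `(0, y₀)`. -/
noncomputable def fiberPoint (k : ℕ) {Y : Type v} [MetricSpace Y] {y₀ y : Y} {R : ℝ}
    (hy : dist y y₀ ≤ R) : Metric.closedBall (base k y₀) R :=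
  ⟨base k y, by
    refine (dist_le_add _ _).trans ?_
    simpa [base] using hy⟩

open scoped InnerProductSpace in
/-- The key estimate: a map of small distortion between the balls sends some point `(R u, y₀)` of
the sphere to a point whose Euclidean part is at most about `R` away from that of the image of
`(0, y)`. -/
theorem exists_euclidean_dist {n : ℕ} {X : Type u} {Y : Type v} [MetricSpace X] [MetricSpace Y]
    {x₀ : X} {y₀ y : Y} {D R ε δ : ℝ} (hD : ∀ x x' : X, dist x x' ≤ D) (hδ : δ < ε)
    (hR : D + 4 * ε ≤ 2 * R / 3)
    {f : Metric.closedBall (base (n + 1) y₀) R → Metric.closedBall (base (n + 1) x₀) R}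
    (hf : DistortionLE f δ) (hy : dist y y₀ ≤ R) :
    ∃ T, 0 ≤ T ∧ R ^ 2 + dist y y₀ ^ 2 ≤ (√(T ^ 2 + D ^ 2) + ε) ^ 2 ∧ T ≤ R + ε ∧
      (D + 3 * ε ≤ R / 2 → T ≤ R) := by
  have hD0 : 0 ≤ D := dist_nonneg.trans (hD x₀ x₀)
  have hR0 : 0 ≤ R := dist_nonneg.trans hy
  have hδ0 : 0 ≤ δ := by
    simpa using hf (fiberPoint (n + 1) hy) (fiberPoint (n + 1) hy)
  have hε : 0 < ε := hδ0.trans_lt hδ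
  set b := fun u => spherePoint (k := n + 1) y₀ hR0 u with hb
  set w := fun u => (f (b u)).1.fst with hw
  have hw_norm : ∀ u, ‖w u‖ ≤ R := fun u => norm_fst_le _
  have hb_dist : ∀ u u', dist (b u) (b u') = R * dist u u' := by
    intro u u'
    refine (sq_eq_sq₀ dist_nonneg (by positivity)).1 ?_
    rw [Subtype.dist_eq, dist_sq_eq]
    simp [hb, spherePoint, dist_smul₀, mul_pow, Subtype.dist_eq]
  have hw_dist : ∀ u u', dist (w u) (w u') ≤ R * dist u u' + δ := by
    intro u u'
    have h1 : dist (w u) (w u') ≤ dist (f (b u)) (f (b u')) := WithLp.dist_fst_le _ _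
    have h2 := (abs_le.1 (hf (b u) (b u'))).2
    rw [hb_dist] at h2
    linarith
  -- The gap between `δ` and `ε` makes the constant `w u` admissible near `u`, and convexity allows
  -- these local choices to be glued.
  obtain ⟨W, hW⟩ := exists_continuous_forall_mem_convex_of_local_const
    (t := fun u => Metric.closedBall (w u) ε ∩ Metric.closedBall 0 R)
    (fun u => (convex_closedBall _ _).inter (convex_closedBall _ _)) fun u => by
      have hlim : Filter.Tendsto (fun u' => R * dist u u' + δ) (nhds u) (nhds δ) := by
        have : Continuous fun u' => R * dist u u' + δ := by fun_prop
        simpa using this.tendsto u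
      refine ⟨w u, (hlim.eventually (gt_mem_nhds hδ)).mono fun u' hu' => ⟨?_, ?_⟩⟩
      · exact (hw_dist u u').trans hu'.le
      · simpa using hw_norm u
  have hWw : ∀ u, dist (W u) (w u) ≤ ε := fun u => (hW u).1
  have hWR : ∀ u, ‖W u‖ ≤ R := fun u => by simpa using (hW u).2
  have hanti : ∀ u, 2 * R - ε ≤ dist (w u) (w (-u)) + D := by
    intro u
    have h1 := (abs_le.1 (hf (b u) (b (-u)))).1
    have h2 : dist u (-u) = 2 := by
      rw [Subtype.dist_eq, dist_eq_norm]
      have : u.1 - (-u).1 = (2 : ℝ) • u.1 := by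
        rw [coe_neg_sphere, sub_neg_eq_add, two_smul]
      rw [this, norm_smul]
      simp
    have h3 : dist (f (b u)) (f (b (-u))) ≤ dist (w u) (w (-u)) + dist _ _ := dist_le_add _ _
    have h4 := hD (f (b u)).1.snd (f (b (-u))).1.snd
    rw [hb_dist, h2] at h1
    linarith
  have : Fact (Module.finrank ℝ (EuclideanSpace ℝ (Fin (n + 1))) = n + 1) := ⟨by simp⟩
  set v := (f (fiberPoint (n + 1) hy)).1.fst with hv
  have hvR : ‖v‖ ≤ R := norm_fst_le _
  have hray : ∀ {p q : EuclideanSpace ℝ (Fin (n + 1))}, ‖p‖ ≤ R → ‖q‖ ≤ R → SameRay ℝ p q →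
      dist p q ≤ R := by
    intro p q hp hq h
    rw [dist_eq_norm, h.norm_sub, abs_le]
    constructor <;> linarith [norm_nonneg p, norm_nonneg q]
  -- Antipodes sent to one ray would have `W`-images at most `R` apart, hence `R ≤ D + 3 * ε`,
  -- against `hR`.
  rcases exists_sameRay_or_sameRay_neg W v with ⟨u, hu⟩ | ⟨u, hu⟩
  swap
  · have h1 := hray (hWR u) (hWR (-u)) hu
    have h2 := dist_triangle4 (w u) (W u) (W (-u)) (w (-u))
    have h3 := hWw u
    rw [dist_comm] at h3
    linarith [hWw (-u), hanti u]
  refine ⟨dist (w u) v, dist_nonneg, ?_, ?_, ?_⟩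
  · have h1 : dist (b u) (fiberPoint (n + 1) hy) ^ 2 = R ^ 2 + dist y y₀ ^ 2 := by
      rw [Subtype.dist_eq, dist_sq_eq]
      simp [hb, spherePoint, fiberPoint, base, norm_smul, dist_comm]
    have h2 := (abs_le.1 (hf (b u) (fiberPoint (n + 1) hy))).1
    have h3 : dist (f (b u)) (f (fiberPoint (n + 1) hy)) ≤ √(dist (w u) v ^ 2 + D ^ 2) := by
      refine Real.le_sqrt_of_sq_le ?_
      rw [Subtype.dist_eq, dist_sq_eq]
      gcongr
      exact hD _ _
    rw [← h1]
    gcongr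
    linarith
  · have h1 := dist_triangle (w u) (W u) v
    have h2 := hWw u
    rw [dist_comm] at h2
    linarith [hray (hWR u) hvR hu]
  -- Antipodes stay far apart, so `‖W u‖ ≥ R - D - 2 * ε`. Then `2 * (‖W u‖ - ε) ≥ R ≥ ‖v‖`, and
  -- expanding `‖w u - v‖ ^ 2` removes the error `ε` from the bound on `T`.
  · intro hsmall
    have h1 := hWw u
    have h2 : ‖w u‖ ≤ ‖W u‖ + ε := by
      have := norm_le_norm_add_norm_sub (W u) (w u)
      rw [← dist_eq_norm] at this
      linarith
    have h3 : dist (w u) (w (-u)) ≤ ‖w u‖ + ‖w (-u)‖ := dist_le_norm_add_norm _ _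
    have h4 : ⟪w u, v⟫_ℝ ≥ ‖W u‖ * ‖v‖ - ε * ‖v‖ := by
      have h5 : ⟪W u, v⟫_ℝ = ‖W u‖ * ‖v‖ :=
        inner_eq_norm_mul_iff_real.2 (sameRay_iff_norm_smul_eq.1 hu).symm
      have h6 : ⟪W u - w u, v⟫_ℝ ≤ ε * ‖v‖ := by
        refine (real_inner_le_norm _ _).trans ?_
        rw [← dist_eq_norm]
        gcongr
      rw [inner_sub_left] at h6
      linarith
    refine abs_le_of_sq_le_sq' ?_ hR0 |>.2
    rw [dist_eq_norm, norm_sub_sq_real]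
    have h7 : ‖w u‖ ^ 2 ≤ R ^ 2 := by gcongr; exact hw_norm u
    have h8 : 0 ≤ ‖v‖ * (2 * (‖W u‖ - ε) - ‖v‖) :=
      mul_nonneg (norm_nonneg _) (by linarith [hanti u, hw_norm (-u)])
    linarith

theorem dist_sq_le {k : ℕ} {X : Type u} {Y : Type v} [MetricSpace X] [MetricSpace Y]
    {x₀ : X} {y₀ y : Y} {D R ε δ : ℝ} (hD : ∀ x x' : X, dist x x' ≤ D) (hδ : δ < ε)
    (hR : D + 4 * ε ≤ 2 * R / 3)
    {f : Metric.closedBall (base k y₀) R → Metric.closedBall (base k x₀) R}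
    (hf : DistortionLE f δ) (hy : dist y y₀ ≤ R) :
    dist y y₀ ^ 2 ≤ D ^ 2 + 2 * ε * D + 4 * ε * (R + ε) ∧
      (D + 3 * ε ≤ R / 2 → dist y y₀ ^ 2 ≤ D ^ 2 + 2 * ε * D + 2 * ε * R + ε ^ 2) := by
  have hD0 : 0 ≤ D := dist_nonneg.trans (hD x₀ x₀)
  have hR0 : 0 ≤ R := dist_nonneg.trans hy
  have hδ0 : 0 ≤ δ := by simpa using hf (fiberPoint k hy) (fiberPoint k hy)
  have hε : 0 < ε := hδ0.trans_lt hδ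
  have hεR : 0 ≤ ε * R := by positivity
  rcases k with _ | n
  -- For `k = 0` there is no Euclidean part, and the distortion alone gives `D + ε`.
  · have hR0' : dist y₀ y₀ ≤ R := by rwa [dist_self]
    have h1 := (abs_le.1 (hf (fiberPoint 0 hy) (fiberPoint 0 hR0'))).1
    have h2 : dist (fiberPoint 0 hy) (fiberPoint 0 hR0') = dist y y₀ := by
      refine (sq_eq_sq₀ dist_nonneg dist_nonneg).1 ?_
      rw [Subtype.dist_eq, dist_sq_eq]
      simp [fiberPoint, base]
    have h3 := dist_le_add (f (fiberPoint 0 hy)).1 (f (fiberPoint 0 hR0')).1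
    rw [Subsingleton.elim (f (fiberPoint 0 hy)).1.fst (f (fiberPoint 0 hR0')).1.fst, dist_self,
      zero_add] at h3
    have h4 := hD (f (fiberPoint 0 hy)).1.snd (f (fiberPoint 0 hR0')).1.snd
    have h5 : dist y y₀ ≤ D + ε := by
      rw [h2, Subtype.dist_eq] at h1
      linarith
    have h6 : dist y y₀ ^ 2 ≤ (D + ε) ^ 2 := by gcongr
    exact ⟨by nlinarith, fun _ => by nlinarith⟩
  · obtain ⟨T, hT0, hT, hT1, hT2⟩ := exists_euclidean_dist hD hδ hR hf hy
    have h1 : √(T ^ 2 + D ^ 2) ≤ T + D := by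
      rw [Real.sqrt_le_left (by positivity)]
      nlinarith [mul_nonneg hT0 hD0]
    have h2 := Real.sq_sqrt (show 0 ≤ T ^ 2 + D ^ 2 by positivity)
    have h3 : R ^ 2 + dist y y₀ ^ 2 ≤ T ^ 2 + D ^ 2 + 2 * ε * (T + D) + ε ^ 2 := by
      nlinarith
    constructor
    · nlinarith
    · intro h
      have h4 := hT2 h
      nlinarith

end EuclideanProd

/-! ### From the ball to the whole space. -/

theorem IsLengthSpace.exists_dist_eq {Y : Type v} [MetricSpace Y] (hY : IsLengthSpace Y) {y₀ y : Y}
    {r : ℝ} (hr : 0 ≤ r) (hy : r ≤ dist y y₀) : ∃ z, dist z y₀ = r := by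
  have hne : (⨅ γ : Path y₀ y, eVariationOn γ Set.univ) < ∞ := by
    rw [← hY]; exact edist_lt_top _ _
  obtain ⟨γ, -⟩ := iInf_lt_iff.1 hne
  obtain ⟨t, ht⟩ := intermediate_value_univ (0 : unitInterval) 1
    (show Continuous fun t => dist (γ t) y₀ by fun_prop) ⟨by simpa using hr, by simpa using hy⟩
  exact ⟨γ t, ht⟩

/-- A point outside the ball would force one at distance exactly `R`, where the bound `K < R ^ 2`
fails. -/
theorem IsLengthSpace.forall_dist_le {Y : Type v} [MetricSpace Y] (hY : IsLengthSpace Y) {y₀ : Y}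
    {R K : ℝ} (hR : 0 ≤ R) (h : ∀ y, dist y y₀ ≤ R → dist y y₀ ^ 2 ≤ K) (hK : K < R ^ 2) (y : Y) :
    dist y y₀ ≤ R := by
  by_contra! hy
  obtain ⟨z, hz⟩ := hY.exists_dist_eq hR hy.le
  have := h z hz.le
  rw [hz] at this
  linarith

theorem IsLengthSpace.min_radiusFrom_sq_le {Y : Type v} [MetricSpace Y] (hY : IsLengthSpace Y)
    {y₀ : Y} {R K : ℝ} (hR : 0 ≤ R) (h : ∀ y, dist y y₀ ≤ R → dist y y₀ ^ 2 ≤ K) :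
    min (ENNReal.ofReal R) (radiusFrom y₀) ^ 2 ≤ ENNReal.ofReal K := by
  have hK : 0 ≤ K := by simpa using h y₀ (by simpa using hR)
  rcases lt_or_ge K (R ^ 2) with hlt | hle
  · have h1 : radiusFrom y₀ ≤ ENNReal.ofReal √K := iSup_le fun y => by
      rw [edist_dist]
      exact ENNReal.ofReal_le_ofReal (Real.le_sqrt_of_sq_le (h y (hY.forall_dist_le hR h hlt y)))
    calc min (ENNReal.ofReal R) (radiusFrom y₀) ^ 2 ≤ ENNReal.ofReal √K ^ 2 := by
          gcongr; exact (min_le_right _ _).trans h1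
      _ = ENNReal.ofReal K := by
          rw [← ENNReal.ofReal_pow (Real.sqrt_nonneg _), Real.sq_sqrt hK]
  · calc min (ENNReal.ofReal R) (radiusFrom y₀) ^ 2 ≤ ENNReal.ofReal R ^ 2 := by
          gcongr; exact min_le_left _ _
      _ = ENNReal.ofReal (R ^ 2) := (ENNReal.ofReal_pow hR 2).symm
      _ ≤ ENNReal.ofReal K := ENNReal.ofReal_le_ofReal hle

theorem compactSpace_of_forall_dist_le {Y : Type v} [MetricSpace Y] [ProperSpace Y] {y₀ : Y} {s : ℝ}
    (h : ∀ y, dist y y₀ ≤ s) : CompactSpace Y := by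
  refine ⟨(isCompact_closedBall y₀ s).of_isClosed_subset isClosed_univ fun y _ => h y⟩

theorem diam_univ_le_of_forall_dist_le {Y : Type v} [MetricSpace Y] {y₀ : Y} {s : ℝ}
    (h : ∀ y, dist y y₀ ≤ s) : Metric.diam (Set.univ : Set Y) ≤ 2 * s := by
  refine Metric.diam_le_of_forall_dist_le ?_ fun y _ z _ => ?_
  · linarith [dist_nonneg.trans (h y₀)]
  · linarith [dist_triangle_right y z y₀, h y, h z]

theorem dist_le_diam_univ {X : Type u} [MetricSpace X] [CompactSpace X] (x x' : X) :
    dist x x' ≤ Metric.diam (Set.univ : Set X) :=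
  Metric.dist_le_diam_of_mem isCompact_univ.isBounded (Set.mem_univ x) (Set.mem_univ x')

/-! ### The four claims. -/

theorem mainTheorem6 :
    ∃ c : ℝ, 0 < c ∧
      ∀ (X : Type u) (Y : Type v) [MetricSpace X] [MetricSpace Y]
        [CompactSpace X] [CompleteSpace Y],
        IsLengthSpace X → IsLengthSpace Y →
        ∀ (x₀ : X) (y₀ : Y) (k : ℕ) (R : ℝ) (hR : Metric.diam (Set.univ : Set X) < R),
          (∀ ε : ℝ, 0 < ε →
            Metric.diam (Set.univ : Set X) + 4 * ε ≤ 2 * R / 3 →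
            ballGHDist (Metric.diam_nonneg.trans hR.le)
              (EuclideanProd.base k x₀) (EuclideanProd.base k y₀) < ENNReal.ofReal (ε / 2) →
            (min (ENNReal.ofReal R) (radiusFrom y₀)) ^ 2 ≤
              ENNReal.ofReal (Metric.diam (Set.univ : Set X) ^ 2
                + 2 * ε * Metric.diam (Set.univ : Set X) + 4 * ε * (R + ε))) ∧
          (ProperSpace Y →
            Metric.diam (Set.univ : Set X) = 0 →
            ballGHDist (Metric.diam_nonneg.trans hR.le)
              (EuclideanProd.base k x₀) (EuclideanProd.base k y₀) < ENNReal.ofReal (R / 12) →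
            CompactSpace Y ∧ Metric.diam (Set.univ : Set Y) < 2 * R) ∧
          (ProperSpace Y →
            Metric.diam (Set.univ : Set X) = 1 →
            100 ≤ R →
            ballGHDist (Metric.diam_nonneg.trans hR.le)
              (EuclideanProd.base k x₀) (EuclideanProd.base k y₀)
                < ENNReal.ofReal (1 / (100 * R)) →
            CompactSpace Y ∧ c ≤ Metric.diam (Set.univ : Set Y) ∧
              Metric.diam (Set.univ : Set Y) ≤ 5 * c) ∧
          (1000 * Metric.diam (Set.univ : Set X) ≤ R →
            ENNReal.ofReal R < Metric.ediam (Set.univ : Set Y) / 2 →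
            ENNReal.ofReal (20 * Metric.diam (Set.univ : Set X)) ≤
              ballGHDist (Metric.diam_nonneg.trans hR.le)
                (EuclideanProd.base k x₀) (EuclideanProd.base k y₀)) := by
  -- Up to small terms, claim (c) needs `5 * c ≥ 2 * √1.04` and `c ^ 2 + 0.04 < 1 / 4`. The cruder
  -- bound of (a) would put 0.08 for 0.04, and no `c` would remain.
  refine ⟨0.42, by norm_num, ?_⟩
  intro X Y _ _ _ _ _ hY x₀ y₀ k R hR
  set D := Metric.diam (Set.univ : Set X) with hDdef
  have hD : ∀ x x' : X, dist x x' ≤ D := dist_le_diam_univ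
  have hD0 : 0 ≤ D := Metric.diam_nonneg
  have hR0 : 0 < R := hD0.trans_lt hR
  have bound : ∀ {ε : ℝ}, D + 4 * ε ≤ 2 * R / 3 →
      ballGHDist hR0.le (EuclideanProd.base k x₀) (EuclideanProd.base k y₀)
        < ENNReal.ofReal (ε / 2) →
      ∀ y : Y, dist y y₀ ≤ R →
        dist y y₀ ^ 2 ≤ D ^ 2 + 2 * ε * D + 4 * ε * (R + ε) ∧
        (D + 3 * ε ≤ R / 2 → dist y y₀ ^ 2 ≤ D ^ 2 + 2 * ε * D + 2 * ε * R + ε ^ 2) := by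
    intro ε hε h y hy
    obtain ⟨⟨δ, hδ, f, hf⟩, -⟩ := exists_distortionLE_of_pointedGHDist_lt h
    exact EuclideanProd.dist_sq_le hD hδ hε hf hy
  refine ⟨?_, ?_, ?_, ?_⟩
  · intro ε _ hεR h
    exact hY.min_radiusFrom_sq_le hR0.le fun y hy => (bound hεR h y hy).1
  · intro _ (hX : D = 0) h
    -- The largest `ε` allowed when `D = 0`; the bound becomes `7 / 9 * R ^ 2`, below `(0.9 * R) ^
    -- 2`.
    have hb := bound (ε := R / 6) (by rw [hX]; linarith)
      (by rwa [show R / 6 / 2 = R / 12 by ring])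
    rw [hX] at hb
    have hle := hY.forall_dist_le hR0.le (fun y hy => (hb y hy).1) (by nlinarith)
    have hle' : ∀ y, dist y y₀ ≤ 0.9 * R := fun y =>
      abs_le_of_sq_le_sq' (by nlinarith [(hb y (hle y)).1]) (by positivity) |>.2
    refine ⟨compactSpace_of_forall_dist_le hle, ?_⟩
    linarith [diam_univ_le_of_forall_dist_le hle']
  · intro _ (hX : D = 1) hR100 h
    set ε := 1 / (50 * R) with hε
    have hεR : ε * R = 1 / 50 := by rw [hε]; field_simp
    have hε0 : 0 < ε := by positivity
    have hε1 : ε ≤ 1 / 5000 := by nlinarith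
    have h' : ballGHDist hR0.le (EuclideanProd.base k x₀) (EuclideanProd.base k y₀)
        < ENNReal.ofReal (ε / 2) := by
      rwa [show ε / 2 = 1 / (100 * R) by rw [hε]; field_simp; norm_num]
    have hb := bound (ε := ε) (by rw [hX]; linarith) h'
    rw [hX] at hb
    have hle := hY.forall_dist_le hR0.le (fun y hy => (hb y hy).2 (by linarith)) (by nlinarith)
    have hle' : ∀ y, dist y y₀ ≤ 1.05 := fun y =>
      abs_le_of_sq_le_sq' (by nlinarith [(hb y (hle y)).2 (by linarith)]) (by norm_num) |>.2
    have hdiam := diam_univ_le_of_forall_dist_le hle'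
    have hcomp : CompactSpace Y := compactSpace_of_forall_dist_le hle
    refine ⟨hcomp, ?_, by linarith⟩
    by_contra! hlt
    -- The estimate with `X` and `Y` exchanged: a small `Y` would force `diam X ≤ 0.94`.
    obtain ⟨-, δ, hδ, f, hf⟩ := exists_distortionLE_of_pointedGHDist_lt h'
    have hd0 : 0 ≤ Metric.diam (Set.univ : Set Y) := Metric.diam_nonneg
    have hX' : ∀ x, dist x x₀ ≤ 0.47 := by
      intro x
      have hx := (EuclideanProd.dist_sq_le (D := Metric.diam (Set.univ : Set Y)) dist_le_diam_univ
        hδ (by linarith) hf ((hD x x₀).trans hR.le)).2 (by linarith)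
      exact abs_le_of_sq_le_sq' (by nlinarith) (by norm_num) |>.2
    linarith [diam_univ_le_of_forall_dist_le hX']
  · intro hRD hdiam
    by_contra! h
    have hDpos : 0 < D := by
      by_contra! hD'
      rw [ENNReal.ofReal_of_nonpos (by linarith)] at h
      exact not_lt_zero h
    -- The bound is `6481 * D ^ 2 + 160 * D * R`, below `R ^ 2` because `R ≥ 1000 * D`; so `Y` lies
    -- in the `R`-ball, against its diameter.
    have hb := bound (ε := 40 * D) (by linarith) (by rwa [show 40 * D / 2 = 20 * D by ring])
    have hle := hY.forall_dist_le hR0.le (fun y hy => (hb y hy).1) (by nlinarith)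
    have hed : Metric.ediam (Set.univ : Set Y) ≤ 2 * ENNReal.ofReal R := by
      refine Metric.ediam_le fun y _ z _ => (edist_triangle_right y z y₀).trans ?_
      rw [two_mul, edist_dist, edist_dist]
      exact add_le_add (ENNReal.ofReal_le_ofReal (hle y)) (ENNReal.ofReal_le_ofReal (hle z))
    have h2 : Metric.ediam (Set.univ : Set Y) / 2 ≤ ENNReal.ofReal R :=
      ENNReal.div_le_of_le_mul' hed
    exact absurd hdiam (not_lt.2 h2)
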